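/- Let $k\ge 2$ be an integer. For each odd prime $p$ coprime to $k$ put $F_p(z)=\prod_{n\ge 0}\Phi_p\bigl(z^{k^n}\bigr)$, where $\Phi_p$ is the $p$-th cyclotomic polynomial. Then each of these products converges for $|z|<1$ and defines a function that is equal on the open unit disc to the sum of its Taylor series at $0$, and the infinite family $(F_p)_p$, indexed by all odd primes $p$ coprime to $k$, is algebraically independent over the field $\mathbb{C}(z)$ of rational functions. Here the $F_p$ are regarded, through their Taylor series at $0$, as elements of the field $\mathbb{C}((z))$ of formal Laurent series, which contains $\mathbb{C}(z)$ by expansion at $0$. -/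

import Mathlib

-- makes the standard `ℂ(z)`-algebra structure on `ℂ((z))` (expansion at `0`) available
open scoped RatFunc

noncomputable section

/-- The function `F_p(z) = ∏_{n ≥ 0} Φ_p(z ^ (k ^ n))`, where `Φ_p` is the `p`-th cyclotomic
polynomial. For `k ≥ 2` it is meant on the open unit disc, where the product converges. -/
def cyclotomicProduct (k p : ℕ) (z : ℂ) : ℂ :=
  ∏' n : ℕ, (Polynomial.cyclotomic p ℂ).eval (z ^ (k ^ n))

/-- The Taylor series at `0` of a function `f : ℂ → ℂ`, as a formal power series. -/
def taylorSeriesAtZero (f : ℂ → ℂ) : PowerSeries ℂ :=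
  PowerSeries.mk fun m => iteratedDeriv m f 0 / (m.factorial : ℂ)

/-- The element of the field `ℂ((z))` of formal Laurent series given by the Taylor series of
`F_p` at `0`. -/
def cyclotomicProductSeries (k p : ℕ) : LaurentSeries ℂ :=
  (taylorSeriesAtZero (cyclotomicProduct k p) : LaurentSeries ℂ)

end

/-!
If `F(z) = ∏ₙ P(z ^ k ^ n)` then `F(z) = P(z) F(z ^ k)`, and a monomial in such functions satisfies
the equation whose coefficient is the same monomial in the polynomials `P`. A shortest linear
relation over `ℂ[z]` between monomials, compared with its image under `z ↦ z ^ k`, shows that two of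
the coefficients `a`, `b` satisfy `a / b = r(z ^ k) / r(z)` for a nonzero rational function `r`.
For products of cyclotomic polynomials this is impossible: if `ζ` is a primitive `n`-th root of
unity with `n` coprime to `k`, then `ζ ↦ ζ ^ k` has a finite cycle through `ζ`, on which the orders
of `r(z ^ k) / r(z)` add up to `0`, while those of `∏ₘ Φₘ ^ (e m)` add up to the length of the
cycle times `e n`.
-/

open Polynomial

section SemilinearEquations

/-- Elements `a` and `b` of a domain `R` whose quotient is `σ r / r` for some nonzero `r = P / Q` in
the field of fractions, that is, elements which are cohomologous under the action of `σ`. The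
denominators are cleared, so that no field of fractions is involved. -/
def IsCohomologous {R : Type*} [CommRing R] (σ : R →+* R) (a b : R) : Prop :=
  ∃ P Q : R, P ≠ 0 ∧ Q ≠ 0 ∧ σ Q * P * a = σ P * Q * b

variable {R M ι : Type*} [CommRing R] [AddCommGroup M] [Module R M] {σ : R →+* R} {m : ι → M}

theorem sum_mul_map_smul_eq_zero (τ : M →ₛₗ[σ] M) {a : ι → R} (hτ : ∀ i, m i = a i • τ (m i))
    {s : Finset ι} {c g : ι → R} {A : R} (hc : ∀ i ∈ s, c i * a i = A)
    (hg : ∑ i ∈ s, g i • m i = 0) : ∑ i ∈ s, (c i * σ (g i)) • m i = 0 :=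
  calc ∑ i ∈ s, (c i * σ (g i)) • m i
      = ∑ i ∈ s, A • τ (g i • m i) := Finset.sum_congr rfl fun i hi => by
        rw [map_smulₛₗ, smul_smul, ← hc i hi]
        nth_rewrite 1 [hτ i]
        rw [smul_smul]
        ring_nf
    _ = A • τ (∑ i ∈ s, g i • m i) := by rw [map_sum, Finset.smul_sum]
    _ = 0 := by rw [hg, map_zero, smul_zero]

theorem sum_eliminate_smul_eq_zero [DecidableEq ι] {s : Finset ι} {i₀ : ι} (hi₀ : i₀ ∉ s)
    {g h : ι → R} (hg : ∑ i ∈ insert i₀ s, g i • m i = 0)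
    (hh : ∑ i ∈ insert i₀ s, h i • m i = 0) :
    ∑ i ∈ s, (g i₀ * h i - h i₀ * g i) • m i = 0 := by
  rw [Finset.sum_insert hi₀] at hg hh
  simp only [sub_smul, mul_smul, Finset.sum_sub_distrib, ← Finset.smul_sum]
  rw [eq_neg_of_add_eq_zero_right hg, eq_neg_of_add_eq_zero_right hh, smul_neg, smul_neg,
    smul_comm, sub_self]

theorem linearIndependent_of_pairwise_not_isCohomologous [IsDomain R] [Module.IsTorsionFree R M]
    (τ : M →ₛₗ[σ] M) {a : ι → R} (hm : ∀ i, m i ≠ 0) (hτ : ∀ i, m i = a i • τ (m i))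
    (ha : Pairwise fun i j => ¬ IsCohomologous σ (a i) (a j)) : LinearIndependent R m := by
  classical
  have ha₀ (i : ι) : a i ≠ 0 := fun h => hm i <| by rw [hτ i, h, zero_smul]
  rw [linearIndependent_iff']
  intro s
  induction s using Finset.induction_on with
  | empty => simp
  | insert i₀ s hi₀ ih =>
    intro g hg
    suffices hgi₀ : g i₀ = 0 by
      rw [Finset.sum_insert hi₀, hgi₀, zero_smul, zero_add] at hg
      exact Finset.forall_mem_insert .. |>.2 ⟨hgi₀, ih g hg⟩
    by_contra hgi₀
    set A := ∏ j ∈ insert i₀ s, a j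
    set c : ι → R := fun i => ∏ j ∈ (insert i₀ s).erase i, a j
    have hc : ∀ i ∈ insert i₀ s, c i * a i = A := fun i hi => Finset.prod_erase_mul _ a hi
    have hA : A ≠ 0 := Finset.prod_ne_zero_iff.2 fun j _ => ha₀ j
    have hcoeff := ih _ (sum_eliminate_smul_eq_zero hi₀ hg (sum_mul_map_smul_eq_zero τ hτ hc hg))
    have hgs : ∀ i ∈ s, g i = 0 := by
      intro i hi
      by_contra hgi
      refine ha (ne_of_mem_of_not_mem hi hi₀) ⟨g i, g i₀, hgi, hgi₀, mul_right_cancel₀ hA ?_⟩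
      linear_combination (-a i * a i₀) * hcoeff i hi
        - (a i * σ (g i₀) * g i) * hc i₀ (Finset.mem_insert_self i₀ s)
        + (a i₀ * g i₀ * σ (g i)) * hc i (Finset.mem_insert_of_mem hi)
    rw [Finset.sum_insert hi₀, Finset.sum_eq_zero fun i hi => by rw [hgs i hi, zero_smul],
      add_zero] at hg
    exact smul_ne_zero hgi₀ (hm i₀) hg

end SemilinearEquations

section RootMultiplicity

theorem rootMultiplicity_finsuppProd_pow {R ι : Type*} [CommRing R] [IsDomain R] {P : ι → R[X]}
    (hP : ∀ i, P i ≠ 0) (s : ι →₀ ℕ) (x : R) :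
    (s.prod fun i e => P i ^ e).rootMultiplicity x
      = s.sum fun i e => e * (P i).rootMultiplicity x := by
  classical
  have hs : ∏ i ∈ s.support, P i ^ s i ≠ 0 :=
    Finset.prod_ne_zero_iff.2 fun i _ => pow_ne_zero _ (hP i)
  rw [Finsupp.prod, ← count_roots, roots_prod _ _ hs, Multiset.count_bind]
  simp only [roots_pow, Multiset.count_nsmul, count_roots]
  rfl

theorem rootMultiplicity_cyclotomic {R : Type*} [CommRing R] [IsDomain R] {n q : ℕ}
    [NeZero (q : R)] {ζ : R} (hζ : IsPrimitiveRoot ζ n) :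
    (cyclotomic q R).rootMultiplicity ζ = if q = n then 1 else 0 := by
  classical
  have hq : 0 < q := Nat.pos_of_ne_zero fun h => NeZero.ne (q : R) (by simp [h])
  rw [← count_roots, cyclotomic.roots_eq_primitiveRoots_val,
    Multiset.count_eq_of_nodup (primitiveRoots q R).nodup]
  refine if_congr ?_ rfl rfl
  rw [Finset.mem_val, mem_primitiveRoots hq]
  exact ⟨fun h => h.unique hζ, fun h => h ▸ hζ⟩

variable {K : Type*} [Field K] {k : ℕ}

theorem rootMultiplicity_X_pow_sub_C_pow (hk : (k : K) ≠ 0) {α : K} (hα : α ≠ 0) :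
    (X ^ k - C (α ^ k) : K[X]).rootMultiplicity α = 1 := by
  have hsep : (X ^ k - C (α ^ k) : K[X]).Separable :=
    separable_X_pow_sub_C _ hk (pow_ne_zero k hα)
  refine le_antisymm (rootMultiplicity_le_one_of_separable hsep α) ?_
  exact (rootMultiplicity_pos hsep.ne_zero).2 (by simp)

theorem rootMultiplicity_expand_of_ne_zero (hk : (k : K) ≠ 0) {α : K} (hα : α ≠ 0) (P : K[X]) :
    (expand K k P).rootMultiplicity α = P.rootMultiplicity (α ^ k) := by
  classical
  obtain rfl | hP := eq_or_ne P 0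
  · simp
  have hk₀ : 0 < k := Nat.pos_of_ne_zero fun h => hk (by simp [h])
  obtain ⟨Q, hPQ, hQ⟩ := exists_eq_pow_rootMultiplicity_mul_and_not_dvd P hP (α ^ k)
  have hexpand :
      expand K k P = (X ^ k - C (α ^ k)) ^ P.rootMultiplicity (α ^ k) * expand K k Q := by
    nth_rewrite 1 [hPQ]
    simp
  have hQα : (expand K k Q).rootMultiplicity α = 0 :=
    rootMultiplicity_eq_zero fun hroot => hQ <| dvd_iff_isRoot.2 <| by
      rwa [IsRoot, expand_eval] at hroot
  have hne : expand K k P ≠ 0 := (expand_ne_zero hk₀).2 hP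
  rw [hexpand] at hne ⊢
  rw [rootMultiplicity_mul hne, hQα, ← count_roots, roots_pow, Multiset.count_nsmul, count_roots,
    rootMultiplicity_X_pow_sub_C_pow hk hα, mul_one, add_zero]

theorem IsCohomologous.exists_rootMultiplicity_add_eq (hk : (k : K) ≠ 0) {A B : K[X]} (hA : A ≠ 0)
    (hB : B ≠ 0) (h : IsCohomologous (expand K k).toRingHom A B) :
    ∃ P Q : K[X], ∀ α : K, α ≠ 0 →
      Q.rootMultiplicity (α ^ k) + P.rootMultiplicity α + A.rootMultiplicity α
        = P.rootMultiplicity (α ^ k) + Q.rootMultiplicity α + B.rootMultiplicity α := by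
  obtain ⟨P, Q, hP, hQ, hPQ⟩ := h
  replace hPQ : expand K k Q * P * A = expand K k P * Q * B := hPQ
  refine ⟨P, Q, fun α hα => ?_⟩
  have hk₀ : 0 < k := Nat.pos_of_ne_zero fun h => hk (by simp [h])
  have hPk := (expand_ne_zero hk₀).2 hP
  have hQk := (expand_ne_zero hk₀).2 hQ
  have hmult := congrArg (rootMultiplicity α) hPQ
  rwa [rootMultiplicity_mul (mul_ne_zero (mul_ne_zero hQk hP) hA),
    rootMultiplicity_mul (mul_ne_zero hQk hP),
    rootMultiplicity_mul (mul_ne_zero (mul_ne_zero hPk hQ) hB),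
    rootMultiplicity_mul (mul_ne_zero hPk hQ), rootMultiplicity_expand_of_ne_zero hk hα,
    rootMultiplicity_expand_of_ne_zero hk hα] at hmult

theorem IsCohomologous.sum_rootMultiplicity_eq (hk : (k : K) ≠ 0) {A B : K[X]} (hA : A ≠ 0)
    (hB : B ≠ 0) (h : IsCohomologous (expand K k).toRingHom A B) {α : K} (hα : α ≠ 0) {n : ℕ}
    (hcycle : α ^ k ^ n = α) :
    ∑ i ∈ Finset.range n, A.rootMultiplicity (α ^ k ^ i)
      = ∑ i ∈ Finset.range n, B.rootMultiplicity (α ^ k ^ i) := by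
  obtain ⟨P, Q, hPQ⟩ := h.exists_rootMultiplicity_add_eq hk hA hB
  have hshift (f : K → ℕ) :
      ∑ i ∈ Finset.range n, f (α ^ k ^ (i + 1)) = ∑ i ∈ Finset.range n, f (α ^ k ^ i) := by
    have := (Finset.sum_range_succ' (fun i => f (α ^ k ^ i)) n).symm.trans
      (Finset.sum_range_succ (fun i => f (α ^ k ^ i)) n)
    simpa [hcycle] using this
  have hsum := Finset.sum_congr rfl fun i (_ : i ∈ Finset.range n) =>
    hPQ (α ^ k ^ i) (pow_ne_zero _ hα)
  simp only [← pow_mul, ← pow_succ, Finset.sum_add_distrib] at hsum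
  have hshiftP := hshift fun x => P.rootMultiplicity x
  have hshiftQ := hshift fun x => Q.rootMultiplicity x
  lia

theorem eq_of_isCohomologous_prod_cyclotomic [IsSepClosed K] (hk : (k : K) ≠ 0) {ι : Type*}
    {n : ι → ℕ} (hinj : Function.Injective n) (hn : ∀ i, (n i : K) ≠ 0)
    (hcop : ∀ i, (n i).Coprime k) {s t : ι →₀ ℕ}
    (h : IsCohomologous (expand K k).toRingHom (s.prod fun i e => cyclotomic (n i) K ^ e)
      (t.prod fun i e => cyclotomic (n i) K ^ e)) : s = t := by
  classical
  have (i : ι) : NeZero (n i : K) := ⟨hn i⟩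
  have hne (u : ι →₀ ℕ) : (u.prod fun i e => cyclotomic (n i) K ^ e) ≠ 0 :=
    Finset.prod_ne_zero_iff.2 fun i _ => pow_ne_zero _ (cyclotomic_ne_zero _ K)
  have hmult (u : ι →₀ ℕ) (i : ι) {ξ : K} (hξ : IsPrimitiveRoot ξ (n i)) :
      (u.prod fun j e => cyclotomic (n j) K ^ e).rootMultiplicity ξ = u i := by
    rw [rootMultiplicity_finsuppProd_pow fun j => cyclotomic_ne_zero (n j) K]
    simp [rootMultiplicity_cyclotomic hξ, hinj.eq_iff, Finsupp.sum, eq_comm]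
  ext i
  have hpos : 0 < n i := Nat.pos_of_ne_zero fun h => hn i (by simp [h])
  obtain ⟨ζ, hζ⟩ := HasEnoughRootsOfUnity.exists_primitiveRoot K (n i)
  have hprim (j : ℕ) : IsPrimitiveRoot (ζ ^ k ^ j) (n i) :=
    hζ.pow_of_coprime _ ((hcop i).symm.pow_left j)
  have hcycle : ζ ^ k ^ (n i).totient = ζ := by
    rw [pow_eq_pow_mod _ hζ.pow_eq_one, Nat.ModEq.pow_totient (hcop i).symm,
      ← pow_eq_pow_mod 1 hζ.pow_eq_one, pow_one]
  have hsum := h.sum_rootMultiplicity_eq hk (hne s) (hne t) (hζ.ne_zero hpos.ne') hcycle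
  simp only [hmult _ i (hprim _), Finset.sum_const, Finset.card_range, smul_eq_mul] at hsum
  exact Nat.eq_of_mul_eq_mul_left (Nat.totient_pos.2 hpos) hsum

end RootMultiplicity

section FormalMahlerEquations

theorem algebraicIndependent_of_linearIndependent_monomials {ι R A : Type*} [CommRing R]
    [CommRing A] [Algebra R A] {x : ι → A}
    (h : LinearIndependent R fun s : ι →₀ ℕ => s.prod fun i e => x i ^ e) :
    AlgebraicIndependent R x := by
  rw [algebraicIndependent_iff]
  intro F hF
  have hsum : ∑ s ∈ F.support, F.coeff s • (s.prod fun i e => x i ^ e) = 0 := by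
    simpa only [MvPolynomial.aeval_def, MvPolynomial.eval₂_eq, Algebra.smul_def,
      Finsupp.prod] using hF
  ext s
  by_contra hs
  exact hs (linearIndependent_iff'.1 h F.support F.coeff hsum s (MvPolynomial.mem_support_iff.2 hs))

variable {R : Type*} [CommRing R] {k : ℕ} {ι : Type*}

theorem coe_expand_eq_expand_coe (hk : k ≠ 0) (P : R[X]) :
    (expand R k P : PowerSeries R) = PowerSeries.expand k hk (P : PowerSeries R) := by
  induction P using Polynomial.induction_on' with
  | add P Q hP hQ => simp [hP, hQ]
  | monomial n a => simp [mul_comm]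

/-- The substitution `X ↦ X ^ k` on power series, as a map of `R[X]`-modules that is semilinear with
respect to the same substitution on polynomials. -/
noncomputable def expandSemilinearMap (R : Type*) [CommRing R] {k : ℕ} (hk : k ≠ 0) :
    PowerSeries R →ₛₗ[(expand R k).toRingHom] PowerSeries R where
  toFun := PowerSeries.expand k hk
  map_add' := map_add _
  map_smul' P f := by
    simp [Algebra.smul_def, PowerSeries.algebraMap_apply', coe_expand_eq_expand_coe hk]

theorem finsuppProd_eq_smul_expand (hk : k ≠ 0) {P : ι → R[X]} {T : ι → PowerSeries R}
    (hT : ∀ i, T i = P i * PowerSeries.expand k hk (T i)) (s : ι →₀ ℕ) :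
    (s.prod fun i e => T i ^ e)
      = (s.prod fun i e => P i ^ e) • expandSemilinearMap R hk (s.prod fun i e => T i ^ e) :=
  calc (s.prod fun i e => T i ^ e)
      = s.prod fun i e => ((P i : PowerSeries R) * PowerSeries.expand k hk (T i)) ^ e := by
        simp only [← hT]
    _ = ((s.prod fun i e => P i ^ e : R[X]) : PowerSeries R)
          * PowerSeries.expand k hk (s.prod fun i e => T i ^ e) := by
        rw [← coeToPowerSeries.ringHom_apply]
        simp [Finsupp.prod, mul_pow, Finset.prod_mul_distrib]

theorem linearIndependent_monomials_of_eq_mul_expand [IsDomain R] (hk : k ≠ 0) {P : ι → R[X]}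
    {T : ι → PowerSeries R} (hT₀ : ∀ i, T i ≠ 0)
    (hT : ∀ i, T i = P i * PowerSeries.expand k hk (T i))
    (hP : ∀ s t : ι →₀ ℕ, IsCohomologous (expand R k).toRingHom
      (s.prod fun i e => P i ^ e) (t.prod fun i e => P i ^ e) → s = t) :
    LinearIndependent R[X] fun s : ι →₀ ℕ => s.prod fun i e => T i ^ e := by
  have : Module.IsTorsionFree R[X] (PowerSeries R) :=
    Module.isTorsionFree_iff_algebraMap_injective.2 (coe_injective R)
  exact linearIndependent_of_pairwise_not_isCohomologous (expandSemilinearMap R hk)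
    (fun _ => Finset.prod_ne_zero_iff.2 fun i _ => pow_ne_zero _ (hT₀ i))
    (finsuppProd_eq_smul_expand hk hT) fun s t hst h => hst (hP s t h)

theorem algebraicIndependent_ratFunc_of_linearIndependent_monomials {K : Type*} [Field K]
    {T : ι → PowerSeries K}
    (hT : LinearIndependent K[X] fun s : ι →₀ ℕ => s.prod fun i e => T i ^ e) :
    AlgebraicIndependent (RatFunc K) fun i => (T i : LaurentSeries K) := by
  refine algebraicIndependent_of_linearIndependent_monomials ?_
  rw [← LinearIndependent.iff_fractionRing K[X] (RatFunc K)]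
  have : IsScalarTower K[X] (PowerSeries K) (LaurentSeries K) := .of_algebraMap_eq fun _ => rfl
  let toLaurent := IsScalarTower.toAlgHom K[X] (PowerSeries K) (LaurentSeries K)
  have hinj : Function.Injective toLaurent := HahnSeries.ofPowerSeries_injective
  have hmonomial : (fun s : ι →₀ ℕ => s.prod fun i e => (T i : LaurentSeries K) ^ e)
      = toLaurent.toLinearMap ∘ fun s => s.prod fun i e => T i ^ e := by
    funext s
    simp [toLaurent, Finsupp.prod]
  rw [hmonomial]
  exact hT.map' _ (LinearMap.ker_eq_bot.2 hinj)

end FormalMahlerEquations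

section UnitBall

/-- `f` is the sum of the power series `T` at every point of the open unit ball. Equations between
functions on the ball and between power series are translated into each other through this
relation. -/
def HasSumOnUnitBall {𝕜 : Type*} [NormedField 𝕜] (f : 𝕜 → 𝕜) (T : PowerSeries 𝕜) : Prop :=
  ∀ z : 𝕜, ‖z‖ < 1 → HasSum (fun m => PowerSeries.coeff m T * z ^ m) (f z)

namespace HasSumOnUnitBall

theorem unique {𝕜 : Type*} [NontriviallyNormedField 𝕜] {f : 𝕜 → 𝕜} {T U : PowerSeries 𝕜}
    (hT : HasSumOnUnitBall f T) (hU : HasSumOnUnitBall f U) : T = U := by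
  have hasFPowerSeriesAt {V : PowerSeries 𝕜} (hV : HasSumOnUnitBall f V) : HasFPowerSeriesAt f
      (FormalMultilinearSeries.ofScalars 𝕜 fun m => PowerSeries.coeff m V) 0 := by
    rw [hasFPowerSeriesAt_iff]
    filter_upwards [Metric.ball_mem_nhds (0 : 𝕜) one_pos] with z hz
    simpa [mul_comm] using hV z (by simpa using hz)
  ext m
  simpa using congrArg (fun q => q.coeff m)
    ((hasFPowerSeriesAt hT).eq_formalMultilinearSeries (hasFPowerSeriesAt hU))

theorem mul {𝕜 : Type*} [RCLike 𝕜] {f g : 𝕜 → 𝕜} {T U : PowerSeries 𝕜}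
    (hT : HasSumOnUnitBall f T) (hU : HasSumOnUnitBall g U) :
    HasSumOnUnitBall (fun z => f z * g z) (T * U) := by
  intro z hz
  have hTn := (hT z hz).summable.norm
  have hUn := (hU z hz).summable.norm
  have hcoeff (m : ℕ) : PowerSeries.coeff m (T * U) * z ^ m
      = ∑ x ∈ Finset.HasAntidiagonal.antidiagonal m,
        (PowerSeries.coeff x.1 T * z ^ x.1) * (PowerSeries.coeff x.2 U * z ^ x.2) := by
    rw [PowerSeries.coeff_mul, Finset.sum_mul]
    refine Finset.sum_congr rfl fun x hx => ?_
    rw [← Finset.HasAntidiagonal.mem_antidiagonal.1 hx, pow_add]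
    ring
  simp only [hcoeff]
  rw [← (hT z hz).tsum_eq, ← (hU z hz).tsum_eq,
    tsum_mul_tsum_eq_tsum_sum_antidiagonal_of_summable_norm hTn hUn]
  exact (summable_norm_sum_mul_antidiagonal_of_summable_norm hTn hUn).of_norm.hasSum

variable {𝕜 : Type*} [NormedField 𝕜]

theorem polynomial (P : 𝕜[X]) : HasSumOnUnitBall (fun z => P.eval z) (P : PowerSeries 𝕜) := by
  intro z _
  simp only [eval_eq_sum, Polynomial.sum, coeff_coe]
  exact hasSum_sum_of_ne_finset_zero fun m hm => by simp [notMem_support_iff.1 hm]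

theorem expand {f : 𝕜 → 𝕜} {T : PowerSeries 𝕜} (hT : HasSumOnUnitBall f T) {k : ℕ} (hk : k ≠ 0) :
    HasSumOnUnitBall (fun z => f (z ^ k)) (PowerSeries.expand k hk T) := by
  intro z hz
  refine ((mul_right_injective₀ hk).hasSum_iff fun m hm => ?_).1 ?_
  · rw [PowerSeries.coeff_expand_of_not_dvd, zero_mul]
    rintro ⟨n, rfl⟩
    exact hm ⟨n, rfl⟩
  · have := hT (z ^ k) (by rw [norm_pow]; exact pow_lt_one₀ (norm_nonneg z) hz hk)
    simpa [Function.comp_def, PowerSeries.coeff_expand_mul, pow_mul] using this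

end HasSumOnUnitBall

theorem coeff_taylorSeriesAtZero (f : ℂ → ℂ) (m : ℕ) :
    PowerSeries.coeff m (taylorSeriesAtZero f) = iteratedDeriv m f 0 / m.factorial :=
  PowerSeries.coeff_mk m _

theorem hasSumOnUnitBall_taylorSeriesAtZero {f : ℂ → ℂ}
    (hf : DifferentiableOn ℂ f (Metric.ball 0 1)) :
    HasSumOnUnitBall f (taylorSeriesAtZero f) := by
  intro z hz
  have hterm (m : ℕ) : PowerSeries.coeff m (taylorSeriesAtZero f) * z ^ m
      = (m.factorial : ℂ)⁻¹ • (z - 0) ^ m • iteratedDeriv m f 0 := by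
    rw [coeff_taylorSeriesAtZero, sub_zero, smul_eq_mul, smul_eq_mul]
    ring
  simpa only [hterm] using Complex.hasSum_taylorSeries_on_ball hf (mem_ball_zero_iff.2 hz)

end UnitBall

section MahlerProduct

/-- The infinite product `∏ₙ P(z ^ k ^ n)`, the basic solution of the Mahler equation
`F(z) = P(z) F(z ^ k)`. For `P(0) = 1` and `k ≥ 2` it converges on the open unit ball. -/
noncomputable def mahlerProduct {𝕜 : Type*} [NormedField 𝕜] (k : ℕ) (P : 𝕜[X]) (z : 𝕜) : 𝕜 :=
  ∏' n : ℕ, P.eval (z ^ k ^ n)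

theorem mahlerProduct_zero {𝕜 : Type*} [NormedField 𝕜] {k : ℕ} (hk : k ≠ 0) {P : 𝕜[X]}
    (hP : P.coeff 0 = 1) : mahlerProduct k P 0 = 1 := by
  simp [mahlerProduct, hk, ← coeff_zero_eq_eval_zero, hP]

theorem norm_pow_pow_le {𝕜 : Type*} [NormedField 𝕜] {k : ℕ} (hk : 1 < k) {z : 𝕜} {r : ℝ}
    (hz : ‖z‖ ≤ r) (hr : r ≤ 1) (n : ℕ) : ‖z ^ k ^ n‖ ≤ r ^ n :=
  calc ‖z ^ k ^ n‖ = ‖z‖ ^ k ^ n := norm_pow z _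
    _ ≤ ‖z‖ ^ n :=
        pow_le_pow_of_le_one (norm_nonneg z) (hz.trans hr) (Nat.lt_pow_self hk).le
    _ ≤ r ^ n := pow_le_pow_left₀ (norm_nonneg z) hz n

variable {𝕜 : Type*} [NormedField 𝕜] [ProperSpace 𝕜] {k : ℕ} {P : 𝕜[X]}

theorem exists_norm_eval_sub_coeff_zero_le (P : 𝕜[X]) :
    ∃ c : ℝ, 0 ≤ c ∧ ∀ w : 𝕜, ‖w‖ ≤ 1 → ‖P.eval w - P.coeff 0‖ ≤ c * ‖w‖ := by
  obtain ⟨c, hc⟩ := (isCompact_closedBall (0 : 𝕜) 1).exists_bound_of_continuousOn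
    P.divX.continuous.continuousOn
  refine ⟨c, (norm_nonneg _).trans (hc 0 (by simp)), fun w hw => ?_⟩
  have hdivX : P.eval w - P.coeff 0 = P.divX.eval w * w := by
    nth_rewrite 1 [← divX_mul_X_add P]
    simp
  rw [hdivX, norm_mul]
  gcongr
  exact hc w (by simpa using hw)

theorem hasProdLocallyUniformlyOn_mahlerProduct (hk : 1 < k) (hP : P.coeff 0 = 1) :
    HasProdLocallyUniformlyOn (fun n z => P.eval (z ^ k ^ n)) (mahlerProduct k P)
      (Metric.ball 0 1) := by
  refine hasProdLocallyUniformlyOn_of_forall_compact Metric.isOpen_ball fun K hK hcompact => ?_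
  obtain ⟨r, ⟨hr₀, hr₁⟩, hKr⟩ := exists_pos_lt_subset_ball one_pos hcompact.isClosed hK
  obtain ⟨c, hc₀, hc⟩ := exists_norm_eval_sub_coeff_zero_le P
  have hsummable : Summable fun n => c * r ^ n :=
    (summable_geometric_of_lt_one hr₀.le hr₁).mul_left c
  have hbound (n : ℕ) (z : 𝕜) (hz : z ∈ K) : ‖P.eval (z ^ k ^ n) - 1‖ ≤ c * r ^ n := by
    have hzn : ‖z ^ k ^ n‖ ≤ r ^ n :=
      norm_pow_pow_le hk (mem_ball_zero_iff.1 (hKr hz)).le hr₁.le n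
    calc ‖P.eval (z ^ k ^ n) - 1‖ ≤ c * ‖z ^ k ^ n‖ :=
          hP ▸ hc _ (hzn.trans (pow_le_one₀ hr₀.le hr₁.le))
      _ ≤ c * r ^ n := by gcongr
  have hprod := hsummable.hasProdUniformlyOn_nat_one_add hcompact (.of_forall hbound)
    fun n => (by fun_prop : Continuous fun z : 𝕜 => P.eval (z ^ k ^ n) - 1).continuousOn
  simpa only [add_sub_cancel] using! hprod

theorem multipliable_eval_pow_pow (hk : 1 < k) (hP : P.coeff 0 = 1) {z : 𝕜} (hz : ‖z‖ < 1) :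
    Multipliable fun n => P.eval (z ^ k ^ n) :=
  ((hasProdLocallyUniformlyOn_mahlerProduct hk hP).hasProd (mem_ball_zero_iff.2 hz)).multipliable

theorem mahlerProduct_eq_eval_mul (hk : 1 < k) (hP : P.coeff 0 = 1) {z : 𝕜} (hz : ‖z‖ < 1) :
    mahlerProduct k P z = P.eval z * mahlerProduct k P (z ^ k) := by
  have hzk : ‖z ^ k‖ < 1 := by
    rw [norm_pow]
    exact pow_lt_one₀ (norm_nonneg z) hz (Nat.ne_zero_of_lt hk)
  have hshift (n : ℕ) : P.eval ((z ^ k) ^ k ^ n) = P.eval (z ^ k ^ (n + 1)) := by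
    rw [← pow_mul, pow_succ']
  have hmul := multipliable_eval_pow_pow hk hP hzk
  simp only [mahlerProduct, hshift] at hmul ⊢
  rw [tprod_eq_zero_mul' hmul, pow_zero, pow_one]

end MahlerProduct

section TaylorSeries

variable {k : ℕ} {P : ℂ[X]}

theorem hasSumOnUnitBall_mahlerProduct (hk : 1 < k) (hP : P.coeff 0 = 1) :
    HasSumOnUnitBall (mahlerProduct k P) (taylorSeriesAtZero (mahlerProduct k P)) :=
  hasSumOnUnitBall_taylorSeriesAtZero <|
    (hasProdLocallyUniformlyOn_mahlerProduct hk hP).differentiableOn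
      (.of_forall fun _ => by
        simpa only [Finset.prod_fn] using DifferentiableOn.finsetProd fun _ _ => by fun_prop)
      Metric.isOpen_ball

theorem taylorSeriesAtZero_mahlerProduct_eq_mul_expand (hk : 1 < k) (hP : P.coeff 0 = 1) :
    taylorSeriesAtZero (mahlerProduct k P)
      = P * PowerSeries.expand k (Nat.ne_zero_of_lt hk)
        (taylorSeriesAtZero (mahlerProduct k P)) := by
  have hF := hasSumOnUnitBall_mahlerProduct hk hP
  refine hF.unique fun z hz => ?_
  rw [mahlerProduct_eq_eval_mul hk hP hz]
  exact (HasSumOnUnitBall.polynomial P).mul (hF.expand (Nat.ne_zero_of_lt hk)) z hz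

theorem algebraicIndependent_mahlerProduct (hk : 1 < k) {ι : Type*} {P : ι → ℂ[X]}
    (hP₀ : ∀ i, (P i).coeff 0 = 1)
    (hP : ∀ s t : ι →₀ ℕ, IsCohomologous (expand ℂ k).toRingHom
      (s.prod fun i e => P i ^ e) (t.prod fun i e => P i ^ e) → s = t) :
    AlgebraicIndependent (RatFunc ℂ) fun i =>
      (taylorSeriesAtZero (mahlerProduct k (P i)) : LaurentSeries ℂ) := by
  have hk₀ : k ≠ 0 := Nat.ne_zero_of_lt hk
  have hne (i : ι) : taylorSeriesAtZero (mahlerProduct k (P i)) ≠ 0 := fun h => by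
    simpa [coeff_taylorSeriesAtZero, mahlerProduct_zero hk₀ (hP₀ i)]
      using congrArg (PowerSeries.coeff 0) h
  exact algebraicIndependent_ratFunc_of_linearIndependent_monomials <|
    linearIndependent_monomials_of_eq_mul_expand hk₀ hne
      (fun i => taylorSeriesAtZero_mahlerProduct_eq_mul_expand hk (hP₀ i)) hP

end TaylorSeries

theorem mainTheorem6_general (k : ℕ) (hk : 2 ≤ k) :
    (∀ n : ℕ, 1 < n → ∀ z : ℂ, ‖z‖ < 1 →
      Multipliable (fun j : ℕ => (cyclotomic n ℂ).eval (z ^ (k ^ j))) ∧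
      HasSum
        (fun m : ℕ => PowerSeries.coeff m (taylorSeriesAtZero (cyclotomicProduct k n)) * z ^ m)
        (cyclotomicProduct k n z)) ∧
    AlgebraicIndependent (RatFunc ℂ)
      (fun n : {n : ℕ // 1 < n ∧ n.Coprime k} => cyclotomicProductSeries k n) := by
  constructor
  · intro n hn z hz
    have hΦ : (cyclotomic n ℂ).coeff 0 = 1 := cyclotomic_coeff_zero ℂ hn
    exact ⟨multipliable_eval_pow_pow hk hΦ hz, hasSumOnUnitBall_mahlerProduct hk hΦ z hz⟩
  · refine algebraicIndependent_mahlerProduct hk (fun n => cyclotomic_coeff_zero ℂ n.2.1)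
      fun s t => eq_of_isCohomologous_prod_cyclotomic ?_ Subtype.val_injective ?_ fun n => n.2.2
    · exact_mod_cast (by lia : k ≠ 0)
    · exact fun n => by exact_mod_cast (by have := n.2.1; lia : (n : ℕ) ≠ 0)

theorem mainTheorem6 (k : ℕ) (hk : 2 ≤ k) :
    (∀ p : ℕ, p.Prime → Odd p → p.Coprime k → ∀ z : ℂ, ‖z‖ < 1 →
      Multipliable (fun n : ℕ => (Polynomial.cyclotomic p ℂ).eval (z ^ (k ^ n))) ∧
      HasSum
        (fun m : ℕ => PowerSeries.coeff m (taylorSeriesAtZero (cyclotomicProduct k p)) * z ^ m)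
        (cyclotomicProduct k p z)) ∧
    AlgebraicIndependent (RatFunc ℂ)
      (fun p : {p : ℕ // p.Prime ∧ Odd p ∧ p.Coprime k} => cyclotomicProductSeries k p) :=
  ⟨fun p hp _ _ => (mainTheorem6_general k hk).1 p hp.one_lt,
    (mainTheorem6_general k hk).2.comp
      (fun p : {p : ℕ // p.Prime ∧ Odd p ∧ p.Coprime k} => ⟨p, p.2.1.one_lt, p.2.2.2⟩)
      fun _ _ h => Subtype.ext (Subtype.mk.inj h)⟩
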